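/- Let $V$ be a finite-dimensional real Euclidean space with inner product $\langle-,-\rangle$, and for $0\ne\alpha\in V$ let $s_\alpha$ be the orthogonal reflection $v\mapsto v-\frac{2\langle v,\alpha\rangle}{\langle\alpha,\alpha\rangle}\alpha$. Let $\Phi\subseteq V\setminus\{0\}$ be a root system, i.e. a finite set with $s_\alpha(\beta)\in\Phi$ for $\alpha,\beta\in\Phi$, and such that $\alpha,c\alpha\in\Phi$ with $c\in\mathbb R$ implies $c=\pm1$; let $W=\langle s_\alpha\mid\alpha\in\Phi\rangle$. For $A\subseteq\Phi$ put $W_A=\langle s_\alpha\mid\alpha\in A\rangle$ and $\Phi_A=\{\alpha\in\Phi\mid s_\alpha\in W_A\}$; the sets $\Phi_A$ are the root subsystems of $\Phi$. A simple system of a root system $\Psi$ is a linearly independent subset $\Delta\subseteq\Psi$ with $\Psi=\Psi_+\sqcup(-\Psi_+)$, where $\Psi_+=\Psi\cap\mathbb R_{\ge0}\Delta$. A simple subsystem $\Gamma$ of $\Phi$ is a simple system of some root subsystem of $\Phi$; put $\Phi_{\Gamma,+}=\Phi_\Gamma\cap\mathbb R_{\ge0}\Gamma$ and $S_\Gamma=\{s_\alpha\mid\alpha\in\Gamma\}$.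 For simple subsystems $\Gamma',\Gamma$ with $W_{\Gamma'}\subseteq W_\Gamma$ let $${}^{\Gamma'}W_\Gamma=\{w\in W_\Gamma\mid w^{-1}(\Gamma')\subseteq\Phi_{\Gamma,+}\},$$ a set of representatives of $W_{\Gamma'}\backslash W_\Gamma$. For $\Delta\subseteq\Gamma$ let $\mathcal C_{\Gamma,\Delta}=\{v\in V\mid \langle v,\alpha\rangle>0\ (\alpha\in\Gamma\setminus\Delta),\ \langle v,\alpha\rangle=0\ (\alpha\in\Delta)\}$. Let $\mathcal I^{(n)}_\Gamma$ be the set of sequences $\boldsymbol\Gamma=(\Gamma_0,\dots,\Gamma_n)$ with $\Gamma=\Gamma_0\supseteq\Gamma_1\supseteq\dots\supseteq\Gamma_n$, and put $\mathcal X_{\boldsymbol\Gamma}=\mathcal C_{\Gamma_0,\Gamma_1}\times\dots\times\mathcal C_{\Gamma_{n-1},\Gamma_n}\subseteq V^n$. With $W$ acting diagonally on $V^n$, the $(W_\Gamma,S_\Gamma)$-strata of $V^n$ are the sets $u(\mathcal X_{\boldsymbol\Gamma})$ with $u\in W_\Gamma$ and $\boldsymbol\Gamma\in\mathcal I^{(n)}_\Gamma$.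 The dimension of a non-empty cone is the dimension of its linear span. **Theorem.** Let $\Gamma,\Lambda$ be simple subsystems of $\Phi$ with $W_\Gamma\subseteq W_\Lambda$, and let $n\ge1$. 1. The topological closure of any $(W_\Gamma,S_\Gamma)$-stratum of $V^n$ is a union of $(W_\Lambda,S_\Lambda)$-strata of $V^n$. 2. Explicitly, let $u(\mathcal X_{\boldsymbol\Gamma})$ be a $(W_\Gamma,S_\Gamma)$-stratum, where $u\in W_\Gamma$ and $\boldsymbol\Gamma=(\Gamma_0,\dots,\Gamma_n)\in\mathcal I^{(n)}_\Gamma$, and put $\Gamma_i'=u(\Gamma_i)$. Then $$\overline{u(\mathcal X_{\boldsymbol\Gamma})}=\bigcup_{\mathbf w,\boldsymbol\Lambda}w_n\cdots w_1(\mathcal X_{\boldsymbol\Lambda}),$$ where the union is over all $\mathbf w=(w_1,\dots,w_n)\in W^n$ and $\boldsymbol\Lambda=(\Lambda_0,\dots,\Lambda_n)\in\mathcal I^{(n)}_\Lambda$ such that for $i=1,\dots,n$: (i) $w_i\in{}^{\Gamma'_{i-1}}W_{w_{i-1}\cdots w_1(\Lambda_{i-1})}$, and (ii) $W_{w_i\cdots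 w_1(\Lambda_i)}\supseteq W_{\Gamma'_i}$. 3. The closure of any $(W_\Gamma,S_\Gamma)$-stratum $F$ of $V^n$ is the disjoint union of $F$ and of $(W_\Gamma,S_\Gamma)$-strata of $V^n$ of dimension strictly less than $\dim F$. 4. Every $(W_\Gamma,S_\Gamma)$-stratum of $V^n$ is a union of $(W_\Lambda,S_\Lambda)$-strata of $V^n$. -/

import Mathlib

open scoped NNReal InnerProductSpace

namespace ReflStrata

noncomputable section

variable {V : Type*} [NormedAddCommGroup V] [InnerProductSpace ℝ V]

/-- The orthogonal reflection `s_α` in (the hyperplane orthogonal to) `α`. -/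
def refl (α : V) : V ≃ₗᵢ[ℝ] V := (ℝ ∙ α)ᗮ.reflection

theorem refl_apply (α v : V) : refl α v = v - (2 * ⟪v, α⟫_ℝ / ⟪α, α⟫_ℝ) • α := by
  rw [refl, Submodule.reflection_orthogonal_apply, Submodule.reflection_singleton_apply]
  rw [real_inner_comm, real_inner_self_eq_norm_sq, neg_sub, ← Nat.cast_smul_eq_nsmul ℝ, smul_smul]
  congr 2
  push_cast
  simp only [RCLike.ofReal_real_eq_id, id]
  ring

/-- A (finite, reduced, not necessarily crystallographic or spanning) root system in `V`. -/
structure IsRootSystem (Φ : Set V) : Prop where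
  finite : Φ.Finite
  zero_notMem : (0 : V) ∉ Φ
  refl_mem : ∀ α ∈ Φ, ∀ β ∈ Φ, refl α β ∈ Φ
  reduced : ∀ α ∈ Φ, ∀ c : ℝ, c • α ∈ Φ → c = 1 ∨ c = -1

/-- The group generated by the reflections `s_α`, `α ∈ A`.  Thus `reflGroup Φ` is `W` and
`reflGroup Γ` is `W_Γ`. -/
def reflGroup (A : Set V) : Subgroup (V ≃ₗᵢ[ℝ] V) := Subgroup.closure (refl '' A)

/-- The roots `{α ∈ Φ | s_α ∈ W'}` of a subgroup `W'`. -/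
def rootsOf (Φ : Set V) (W' : Subgroup (V ≃ₗᵢ[ℝ] V)) : Set V := {α | α ∈ Φ ∧ refl α ∈ W'}

/-- A root subsystem of `Φ`: the set of roots of a subgroup generated by some of the
reflections `s_α`, `α ∈ Φ`. -/
def IsRootSubsystem (Φ Ψ : Set V) : Prop := ∃ A ⊆ Φ, Ψ = rootsOf Φ (reflGroup A)

/-- The elements of `Ψ` that are non-negative real linear combinations of elements of `Δ`. -/
def posRoots (Ψ Δ : Set V) : Set V := Ψ ∩ (Submodule.span ℝ≥0 Δ : Set V)

/-- `Δ` is a simple system of the root system `Ψ`. -/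
structure IsSimpleSystem (Ψ Δ : Set V) : Prop where
  subset : Δ ⊆ Ψ
  linearIndep : LinearIndepOn ℝ id Δ
  union_eq : Ψ = posRoots Ψ Δ ∪ -posRoots Ψ Δ
  disjoint : Disjoint (posRoots Ψ Δ) (-posRoots Ψ Δ)

/-- A simple subsystem of `Φ`: a simple system of some root subsystem of `Φ`. -/
def IsSimpleSubsystem (Φ Γ : Set V) : Prop :=
  ∃ Ψ, IsRootSubsystem Φ Ψ ∧ IsSimpleSystem Ψ Γ

/-- `Φ_{Γ,+}`: the positive roots, with respect to `Γ`, of the root system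
`Φ_Γ = {α ∈ Φ | s_α ∈ W_Γ}`. -/
def subPosRoots (Φ Γ : Set V) : Set V := posRoots (rootsOf Φ (reflGroup Γ)) Γ

/-- `^{Γ'}W_Γ = {w ∈ W_Γ | w⁻¹(Γ') ⊆ Φ_{Γ,+}}`. -/
def cosetReps (Φ Γ' Γ : Set V) : Set (V ≃ₗᵢ[ℝ] V) :=
  {w | w ∈ reflGroup Γ ∧ ⇑w⁻¹ '' Γ' ⊆ subPosRoots Φ Γ}

/-- `𝒞_{Γ,Δ}`. -/
def facet (Γ Δ : Set V) : Set V :=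
  {v | (∀ α ∈ Γ \ Δ, 0 < ⟪v, α⟫_ℝ) ∧ ∀ α ∈ Δ, ⟪v, α⟫_ℝ = 0}

/-- `c ∈ ℐ_Γ^{(n)}`, i.e. `Γ = c 0 ⊇ c 1 ⊇ ⋯ ⊇ c n`. -/
def IsFlag (Γ : Set V) {n : ℕ} (c : Fin (n + 1) → Set V) : Prop := c 0 = Γ ∧ Antitone c

/-- `𝒳_c = 𝒞_{c 0, c 1} × ⋯ × 𝒞_{c (n-1), c n} ⊆ V^n`. -/
def stdStratum {n : ℕ} (c : Fin (n + 1) → Set V) : Set (Fin n → V) :=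
  {v | ∀ i : Fin n, v i ∈ facet (c i.castSucc) (c i.succ)}

/-- The diagonal action of an isometry of `V` on `V^n`. -/
def diag (n : ℕ) (w : V ≃ₗᵢ[ℝ] V) (v : Fin n → V) : Fin n → V := fun i => w (v i)

/-- `F` is a `(W_Γ, S_Γ)`-stratum of `V^n`. -/
def IsStratum (Γ : Set V) {n : ℕ} (F : Set (Fin n → V)) : Prop :=
  ∃ u ∈ reflGroup Γ, ∃ c : Fin (n + 1) → Set V, IsFlag Γ c ∧ F = diag n u '' stdStratum c

/-- The product `w_k ⋯ w_1`, where `w_k` (for `1 ≤ k ≤ n`) is the entry of `w` with index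
`k - 1` in `Fin n`. -/
def revProd {n : ℕ} (w : Fin n → (V ≃ₗᵢ[ℝ] V)) (k : Fin (n + 1)) : V ≃ₗᵢ[ℝ] V :=
  Fin.induction (motive := fun _ => V ≃ₗᵢ[ℝ] V) 1 (fun i p => w i * p) k

theorem revProd_zero {n : ℕ} (w : Fin n → (V ≃ₗᵢ[ℝ] V)) : revProd w 0 = 1 := rfl

theorem revProd_succ {n : ℕ} (w : Fin n → (V ≃ₗᵢ[ℝ] V)) (i : Fin n) :
    revProd w i.succ = w i * revProd w i.castSucc := rfl

/-- The index condition `P(w, d)` relative to the flag `c`: for `k = 1, …, n`,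
(i) `w_k ∈ ^{c_{k-1}}W_{w_{k-1}⋯w_1(d_{k-1})}`, and (ii) `W_{w_k⋯w_1(d_k)} ⊇ W_{c_k}`. -/
def ClosureIndex (Φ : Set V) {n : ℕ} (c : Fin (n + 1) → Set V) (w : Fin n → (V ≃ₗᵢ[ℝ] V))
    (d : Fin (n + 1) → Set V) : Prop :=
  (∀ i : Fin n, w i ∈ cosetReps Φ (c i.castSucc) (revProd w i.castSucc '' d i.castSucc)) ∧
  (∀ i : Fin n, reflGroup (c i.succ) ≤ reflGroup (revProd w i.succ '' d i.succ))

/-- The dimension of a cone in `V^n`: the dimension of its linear span. -/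
def coneDim {n : ℕ} (F : Set (Fin n → V)) : ℕ := Module.finrank ℝ (Submodule.span ℝ F)

end

end ReflStrata

/-!
Weakening the strict inequalities that define a facet gives its closure, so the closure of the
product `u(𝒳_c) = 𝒳_{u(c)}` is a product of closed facets. A vector `v` that is dominant for `Γ`
is made dominant for `Λ` by a `w⁻¹` with `w ∈ ^ΓW_Λ`, and then lies in `w(𝒞_{Λ,Δ})` for the set
`Δ` of simple roots orthogonal to `w⁻¹ v`; by the exchange condition the stabiliser of `w⁻¹ v` in
`W_Λ` is `W_Δ`. This is part 2 for `n = 1`. In general `w_1, …, w_n` are chosen successively: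
`w_{k+1}` lies in a group generated by reflections fixing the first `k` components, so later
choices do not disturb earlier ones. Part 1 follows from part 2, and parts 3 and 4 use in addition
that a stratum is relatively open in its linear span.
-/

namespace ReflStrata

variable {V : Type*} [NormedAddCommGroup V] [InnerProductSpace ℝ V]

/-! ### Groups generated by reflections -/

section Reflections

theorem refl_self (α : V) : refl α α = -α :=
  Submodule.reflection_orthogonalComplement_singleton_eq_neg α

theorem refl_mul_self (α : V) : refl α * refl α = 1 :=
  Submodule.reflection_mul_reflection _

theorem refl_inv (α : V) : (refl α)⁻¹ = refl α :=
  Submodule.reflection_inv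

theorem refl_eq_self_iff {α v : V} : refl α v = v ↔ ⟪v, α⟫_ℝ = 0 :=
  (Submodule.reflection_eq_self_iff v).trans Submodule.mem_orthogonal_singleton_iff_inner_left

theorem inner_inv_apply (w : V ≃ₗᵢ[ℝ] V) (x y : V) : ⟪w⁻¹ x, y⟫_ℝ = ⟪x, w y⟫_ℝ :=
  w.symm.inner_map_eq_flip x y

theorem apply_inv_apply (w : V ≃ₗᵢ[ℝ] V) (x : V) : w (w⁻¹ x) = x := w.apply_symm_apply x

theorem inv_apply_apply (w : V ≃ₗᵢ[ℝ] V) (x : V) : w⁻¹ (w x) = x := w.symm_apply_apply x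

theorem mul_image (w w' : V ≃ₗᵢ[ℝ] V) (A : Set V) : ⇑(w * w') '' A = w '' (w' '' A) :=
  Set.image_comp w w' A

theorem refl_apply_eq_conj (w : V ≃ₗᵢ[ℝ] V) (α : V) : refl (w α) = w * refl α * w⁻¹ := by
  ext v
  change refl (w α) v = w (refl α (w⁻¹ v))
  rw [refl_apply, refl_apply, map_sub, map_smul, apply_inv_apply, inner_inv_apply, w.inner_map_map]

theorem refl_mem_reflGroup {A : Set V} {α : V} (hα : α ∈ A) : refl α ∈ reflGroup A :=
  Subgroup.subset_closure ⟨α, hα, rfl⟩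

theorem reflGroup_le_iff {A : Set V} {H : Subgroup (V ≃ₗᵢ[ℝ] V)} :
    reflGroup A ≤ H ↔ ∀ α ∈ A, refl α ∈ H := by
  rw [reflGroup, Subgroup.closure_le, Set.image_subset_iff]
  rfl

theorem reflGroup_mono {A B : Set V} (h : A ⊆ B) : reflGroup A ≤ reflGroup B :=
  Subgroup.closure_mono (Set.image_mono h)

theorem reflGroup_induction {A : Set V} {P : (V ≃ₗᵢ[ℝ] V) → Prop} (one : P 1)
    (refl_mul : ∀ α ∈ A, ∀ w, P w → P (refl α * w)) {w : V ≃ₗᵢ[ℝ] V} (hw : w ∈ reflGroup A) :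
    P w := by
  induction hw using Subgroup.closure_induction_left with
  | one => exact one
  | mul_left x hx y _ ih =>
    obtain ⟨α, hα, rfl⟩ := hx
    exact refl_mul α hα y ih
  | inv_mul_cancel x hx y _ ih =>
    obtain ⟨α, hα, rfl⟩ := hx
    rw [refl_inv]
    exact refl_mul α hα y ih

theorem apply_eq_self_of_mem_reflGroup {A : Set V} {w : V ≃ₗᵢ[ℝ] V} (hw : w ∈ reflGroup A) {v : V}
    (hv : ∀ α ∈ A, ⟪v, α⟫_ℝ = 0) : w v = v := by
  refine reflGroup_induction (P := fun w => w v = v) rfl (fun α hα w hwv => ?_) hw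
  change refl α (w v) = v
  rw [hwv, refl_eq_self_iff.2 (hv α hα)]

theorem mem_reflGroup_image_iff (w : V ≃ₗᵢ[ℝ] V) (A : Set V) {g : V ≃ₗᵢ[ℝ] V} :
    g ∈ reflGroup (w '' A) ↔ w⁻¹ * g * w ∈ reflGroup A := by
  have hmap : reflGroup (w '' A) = (reflGroup A).map (MulAut.conj w).toMonoidHom := by
    rw [reflGroup, reflGroup, MonoidHom.map_closure, Set.image_image, Set.image_image]
    simp only [refl_apply_eq_conj]
    rfl
  rw [hmap, Subgroup.mem_map_equiv, MulAut.conj_symm_apply]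

theorem reflGroup_image_of_mem {A : Set V} {w : V ≃ₗᵢ[ℝ] V} (hw : w ∈ reflGroup A) :
    reflGroup (w '' A) = reflGroup A := by
  ext g
  rw [mem_reflGroup_image_iff, Subgroup.mul_mem_cancel_right _ hw,
    Subgroup.mul_mem_cancel_left _ (inv_mem hw)]

end Reflections

section RootSystems

variable {Φ : Set V}

theorem IsRootSystem.apply_mem (hΦ : IsRootSystem Φ) {w : V ≃ₗᵢ[ℝ] V} (hw : w ∈ reflGroup Φ)
    {α : V} (hα : α ∈ Φ) : w α ∈ Φ :=
  reflGroup_induction (P := fun w => w α ∈ Φ) hα (fun β hβ w hwα => hΦ.refl_mem β hβ (w α) hwα) hw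

theorem IsRootSystem.apply_mem_rootsOf (hΦ : IsRootSystem Φ) {H : Subgroup (V ≃ₗᵢ[ℝ] V)}
    (hH : H ≤ reflGroup Φ) {w : V ≃ₗᵢ[ℝ] V} (hw : w ∈ H) {β : V} (hβ : β ∈ rootsOf Φ H) :
    w β ∈ rootsOf Φ H := by
  refine ⟨hΦ.apply_mem (hH hw) hβ.1, ?_⟩
  rw [refl_apply_eq_conj]
  exact mul_mem (mul_mem hw hβ.2) (inv_mem hw)

/-- An element of `W` is determined by the permutation it induces on `Φ`, because `W` fixes the
orthogonal complement of `Φ` pointwise. -/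
theorem IsRootSystem.finite_reflGroup (hΦ : IsRootSystem Φ) :
    (reflGroup Φ : Set (V ≃ₗᵢ[ℝ] V)).Finite := by
  have := hΦ.finite.to_subtype
  have := FiniteDimensional.span_of_finite ℝ hΦ.finite
  refine Set.Finite.of_injOn (f := fun w (α : Φ) => w α) (t := Set.univ.pi fun _ => Φ)
    (fun w hw α _ => hΦ.apply_mem hw α.2) (fun w hw w' hw' heq => ?_)
    (Set.Finite.pi fun _ => hΦ.finite)
  ext v
  obtain ⟨y, hy, z, hz, rfl⟩ := (Submodule.span ℝ Φ).exists_add_mem_mem_orthogonal v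
  have hzΦ : ∀ α ∈ Φ, ⟪z, α⟫_ℝ = 0 := fun α hα =>
    (Submodule.mem_orthogonal' _ _).1 hz α (Submodule.subset_span hα)
  have hΦww' : Set.EqOn w.toLinearMap w'.toLinearMap Φ := fun α hα => congrFun heq ⟨α, hα⟩
  rw [map_add, map_add, apply_eq_self_of_mem_reflGroup hw hzΦ,
    apply_eq_self_of_mem_reflGroup hw' hzΦ]
  exact congrArg (· + z) (LinearMap.eqOn_span hΦww' hy)

end RootSystems

/-! ### Nonnegative spans -/

section NonnegativeSpans

variable {A B : Set V} {v β : V}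

theorem inner_nonneg_of_mem_span (hv : ∀ α ∈ A, 0 ≤ ⟪v, α⟫_ℝ)
    (hβ : β ∈ Submodule.span ℝ≥0 A) : 0 ≤ ⟪v, β⟫_ℝ := by
  induction hβ using Submodule.span_induction with
  | mem x hx => exact hv x hx
  | zero => simp
  | add x y _ _ hx hy => rw [inner_add_right]; exact add_nonneg hx hy
  | smul a x _ hx => rw [NNReal.smul_def, inner_smul_right]; exact mul_nonneg a.2 hx

theorem inner_pos_of_mem_span (hv : ∀ α ∈ A, 0 < ⟪v, α⟫_ℝ)
    (hβ : β ∈ Submodule.span ℝ≥0 A) (hβ0 : β ≠ 0) : 0 < ⟪v, β⟫_ℝ := by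
  suffices β = 0 ∨ 0 < ⟪v, β⟫_ℝ from this.resolve_left hβ0
  clear hβ0
  induction hβ using Submodule.span_induction with
  | mem x hx => exact .inr (hv x hx)
  | zero => exact .inl rfl
  | add x y _ _ hx hy =>
    rcases hx with rfl | hx
    · rwa [zero_add]
    rcases hy with rfl | hy
    · rw [add_zero]; exact .inr hx
    · rw [inner_add_right]; exact .inr (add_pos hx hy)
  | smul a x _ hx =>
    rw [NNReal.smul_def, inner_smul_right, smul_eq_zero, NNReal.coe_eq_zero]
    rcases eq_or_ne a 0 with ha | ha
    · exact .inl (.inl ha)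
    · exact hx.imp .inr (mul_pos (NNReal.coe_pos.2 (pos_iff_ne_zero.2 ha)))

/-- `{α ∈ A | ⟨v, α⟩ = 0}`: for dominant `v` this is the face of the cone over `A` cut out by `v`,
and the set `Δ` for which `v ∈ 𝒞_{A,Δ}`. -/
def orthPart (A : Set V) (v : V) : Set V := {α ∈ A | ⟪v, α⟫_ℝ = 0}

theorem orthPart_subset : orthPart A v ⊆ A := Set.sep_subset _ _

theorem mem_span_orthPart (hv : ∀ α ∈ A, 0 ≤ ⟪v, α⟫_ℝ) (hβ : β ∈ Submodule.span ℝ≥0 A)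
    (hvβ : ⟪v, β⟫_ℝ ≤ 0) : β ∈ Submodule.span ℝ≥0 (orthPart A v) := by
  rw [← Set.union_sdiff_cancel (orthPart_subset (A := A) (v := v)), Submodule.span_union,
    Submodule.mem_sup] at hβ
  obtain ⟨y, hy, z, hz, rfl⟩ := hβ
  have hvy : 0 ≤ ⟪v, y⟫_ℝ := inner_nonneg_of_mem_span (fun α hα => hα.2.ge) hy
  have hpos : ∀ α ∈ A \ orthPart A v, 0 < ⟪v, α⟫_ℝ := fun α hα =>
    (hv α hα.1).lt_of_ne fun h => hα.2 ⟨hα.1, h.symm⟩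
  have hz0 : z = 0 := by
    by_contra hz0
    have hvz := inner_pos_of_mem_span hpos hz hz0
    rw [inner_add_right] at hvβ
    linarith
  rwa [hz0, add_zero]

theorem exists_inner_eq (hfin : A.Finite) (hA : LinearIndepOn ℝ id A) (f : V → ℝ) :
    ∃ v : V, ∀ α ∈ A, ⟪v, α⟫_ℝ = f α := by
  have := FiniteDimensional.span_of_finite ℝ hfin
  let b := Module.Basis.extend hA
  let φ := (b.constr ℝ fun x => f x).domRestrict (Submodule.span ℝ A)
  let v := (InnerProductSpace.toDual ℝ _).symm (LinearMap.toContinuousLinearMap φ)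
  refine ⟨v, fun α hα => ?_⟩
  let x : Submodule.span ℝ A := ⟨α, Submodule.subset_span hα⟩
  calc ⟪(v : V), α⟫_ℝ = φ x := InnerProductSpace.toDual_symm_apply (x := x)
    _ = b.constr ℝ (fun x => f x) α := rfl
    _ = f α := by
        have := b.constr_basis ℝ (fun x => f x) ⟨α, LinearIndepOn.subset_extend hA _ hα⟩
        rwa [Module.Basis.extend_apply_self] at this

/-- Face functionals: a linearly independent set spans a simplicial cone, so each of its subsets
is a face. -/
theorem exists_nonneg_orthPart_eq (hfin : A.Finite) (hA : LinearIndepOn ℝ id A) (hB : B ⊆ A) :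
    ∃ v : V, (∀ α ∈ A, 0 ≤ ⟪v, α⟫_ℝ) ∧ orthPart A v = B := by
  classical
  obtain ⟨v, hv⟩ := exists_inner_eq hfin hA fun α => if α ∈ B then 0 else 1
  refine ⟨v, fun α hα => ?_, Set.ext fun α => ⟨fun ⟨hα, h0⟩ => ?_, fun hα => ⟨hB hα, ?_⟩⟩⟩
  · rw [hv α hα]; split_ifs <;> norm_num
  · by_contra hαB
    simp [hv α hα, hαB] at h0
  · rw [hv α (hB hα), if_pos hα]

theorem exists_inner_pos (hfin : A.Finite) (hA : LinearIndepOn ℝ id A) :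
    ∃ v : V, ∀ α ∈ A, 0 < ⟪v, α⟫_ℝ := by
  obtain ⟨v, hv⟩ := exists_inner_eq hfin hA fun _ => 1
  exact ⟨v, fun α hα => (hv α hα).symm ▸ one_pos⟩

theorem eq_zero_of_mem_span_of_neg_mem_span (hfin : A.Finite) (hA : LinearIndepOn ℝ id A)
    (hβ : β ∈ Submodule.span ℝ≥0 A) (hβneg : -β ∈ Submodule.span ℝ≥0 A) : β = 0 := by
  obtain ⟨v, hv⟩ := exists_inner_pos hfin hA
  by_contra hβ0
  have hpos := inner_pos_of_mem_span hv hβ hβ0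
  have hneg := inner_nonneg_of_mem_span (fun α hα => (hv α hα).le) hβneg
  rw [inner_neg_right] at hneg
  linarith

end NonnegativeSpans

/-! ### Simple subsystems -/

section SimpleSubsystems

variable {Φ Γ Λ Δ : Set V} {α β : V} {w : V ≃ₗᵢ[ℝ] V}

theorem isSimpleSubsystem_iff (hΦ : IsRootSystem Φ) :
    IsSimpleSubsystem Φ Γ ↔ Γ ⊆ Φ ∧ LinearIndepOn ℝ id Γ ∧
      ∀ β ∈ rootsOf Φ (reflGroup Γ),
        β ∈ Submodule.span ℝ≥0 Γ ∨ -β ∈ Submodule.span ℝ≥0 Γ := by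
  constructor
  · rintro ⟨_, ⟨A, -, rfl⟩, hΓ⟩
    have hle : reflGroup Γ ≤ reflGroup A := reflGroup_le_iff.2 fun α hα => (hΓ.subset hα).2
    refine ⟨fun α hα => (hΓ.subset hα).1, hΓ.linearIndep, fun β hβ => ?_⟩
    have hβA : β ∈ rootsOf Φ (reflGroup A) := ⟨hβ.1, hle hβ.2⟩
    rw [hΓ.union_eq] at hβA
    exact hβA.imp And.right And.right
  · rintro ⟨hsub, hli, hspan⟩
    have hneg : ∀ β ∈ rootsOf Φ (reflGroup Γ), -β ∈ rootsOf Φ (reflGroup Γ) := fun β hβ =>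
      refl_self β ▸ hΦ.apply_mem_rootsOf (reflGroup_mono hsub) hβ.2 hβ
    refine ⟨_, ⟨Γ, hsub, rfl⟩, fun α hα => ⟨hsub hα, refl_mem_reflGroup hα⟩, hli, ?_, ?_⟩
    · refine Set.Subset.antisymm (fun β hβ => ?_) (Set.union_subset Set.inter_subset_left ?_)
      · exact (hspan β hβ).imp (⟨hβ, ·⟩) (⟨hneg β hβ, ·⟩)
      · exact fun β hβ => neg_neg β ▸ hneg (-β) hβ.1
    · refine Set.disjoint_left.2 fun β hβ hβneg => hΦ.zero_notMem ?_
      exact eq_zero_of_mem_span_of_neg_mem_span (hΦ.finite.subset hsub) hli hβ.2 hβneg.2 ▸ hβ.1.1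

namespace IsSimpleSubsystem

theorem subset (hΦ : IsRootSystem Φ) (hΓ : IsSimpleSubsystem Φ Γ) : Γ ⊆ Φ :=
  ((isSimpleSubsystem_iff hΦ).1 hΓ).1

theorem linearIndepOn (hΦ : IsRootSystem Φ) (hΓ : IsSimpleSubsystem Φ Γ) : LinearIndepOn ℝ id Γ :=
  ((isSimpleSubsystem_iff hΦ).1 hΓ).2.1

theorem mem_or_neg_mem (hΦ : IsRootSystem Φ) (hΓ : IsSimpleSubsystem Φ Γ)
    (hβ : β ∈ rootsOf Φ (reflGroup Γ)) :
    β ∈ Submodule.span ℝ≥0 Γ ∨ -β ∈ Submodule.span ℝ≥0 Γ :=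
  ((isSimpleSubsystem_iff hΦ).1 hΓ).2.2 β hβ

theorem finite (hΦ : IsRootSystem Φ) (hΓ : IsSimpleSubsystem Φ Γ) : Γ.Finite :=
  hΦ.finite.subset (hΓ.subset hΦ)

theorem reflGroup_le (hΦ : IsRootSystem Φ) (hΓ : IsSimpleSubsystem Φ Γ) :
    reflGroup Γ ≤ reflGroup Φ :=
  reflGroup_mono (hΓ.subset hΦ)

theorem exists_inner_pos (hΦ : IsRootSystem Φ) (hΓ : IsSimpleSubsystem Φ Γ) :
    ∃ v : V, ∀ α ∈ Γ, 0 < ⟪v, α⟫_ℝ :=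
  ReflStrata.exists_inner_pos (hΓ.finite hΦ) (hΓ.linearIndepOn hΦ)

theorem mono (hΦ : IsRootSystem Φ) (hΓ : IsSimpleSubsystem Φ Γ) (hΔ : Δ ⊆ Γ) :
    IsSimpleSubsystem Φ Δ := by
  refine (isSimpleSubsystem_iff hΦ).2
    ⟨hΔ.trans (hΓ.subset hΦ), (hΓ.linearIndepOn hΦ).mono hΔ, fun β hβ => ?_⟩
  obtain ⟨v, hv, hvΔ⟩ := exists_nonneg_orthPart_eq (hΓ.finite hΦ) (hΓ.linearIndepOn hΦ) hΔ
  have hvβ : ⟪v, β⟫_ℝ = 0 := refl_eq_self_iff.1 <|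
    apply_eq_self_of_mem_reflGroup hβ.2 fun α hα => (hvΔ.symm ▸ hα : α ∈ orthPart Γ v).2
  rw [← hvΔ]
  refine (hΓ.mem_or_neg_mem hΦ ⟨hβ.1, reflGroup_mono hΔ hβ.2⟩).imp (fun h => ?_) (fun h => ?_)
  · exact mem_span_orthPart hv h hvβ.le
  · exact mem_span_orthPart hv h (by rw [inner_neg_right, hvβ, neg_zero])

theorem image (hΦ : IsRootSystem Φ) (hΓ : IsSimpleSubsystem Φ Γ) (hw : w ∈ reflGroup Φ) :
    IsSimpleSubsystem Φ (w '' Γ) := by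
  have hmap : ∀ {β}, w⁻¹ β ∈ Submodule.span ℝ≥0 Γ → β ∈ Submodule.span ℝ≥0 (w '' Γ) := by
    intro β hβ
    have h := Submodule.apply_mem_span_image_of_mem_span (w.toLinearMap.restrictScalars ℝ≥0) hβ
    rwa [show (w.toLinearMap.restrictScalars ℝ≥0) (w⁻¹ β) = β from apply_inv_apply w β] at h
  refine (isSimpleSubsystem_iff hΦ).2 ⟨?_, ?_, fun β hβ => ?_⟩
  · exact Set.image_subset_iff.2 fun α hα => hΦ.apply_mem hw (hΓ.subset hΦ hα)
  · exact LinearIndepOn.id_image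
      (LinearIndepOn.map_injOn (f := w.toLinearMap) (hΓ.linearIndepOn hΦ) w.injective.injOn)
  · have hroot : w⁻¹ β ∈ rootsOf Φ (reflGroup Γ) := by
      refine ⟨hΦ.apply_mem (inv_mem hw) hβ.1, ?_⟩
      rw [refl_apply_eq_conj, inv_inv]
      exact (mem_reflGroup_image_iff w Γ).1 hβ.2
    exact (hΓ.mem_or_neg_mem hΦ hroot).imp hmap fun h => hmap (by rwa [map_neg])

theorem eq_of_neg_refl_mem (hΦ : IsRootSystem Φ) (hΓ : IsSimpleSubsystem Φ Γ) (hα : α ∈ Γ)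
    (hβΦ : β ∈ Φ) (hβ : β ∈ Submodule.span ℝ≥0 Γ)
    (hneg : -refl α β ∈ Submodule.span ℝ≥0 Γ) : β = α := by
  obtain ⟨v, hv, hvα⟩ := exists_nonneg_orthPart_eq (hΓ.finite hΦ) (hΓ.linearIndepOn hΦ)
    (Set.singleton_subset_iff.2 hα)
  have hvα0 : ⟪v, α⟫_ℝ = 0 := (hvα.symm ▸ rfl : α ∈ orthPart Γ v).2
  have hvβ : ⟪v, β⟫_ℝ ≤ 0 := by
    have h := inner_nonneg_of_mem_span hv hneg
    rwa [inner_neg_right, ← inner_inv_apply, refl_inv, refl_eq_self_iff.2 hvα0,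
      neg_nonneg] at h
  have hβα := mem_span_orthPart hv hβ hvβ
  rw [hvα, Submodule.mem_span_singleton] at hβα
  obtain ⟨c, rfl⟩ := hβα
  rcases hΦ.reduced α (hΓ.subset hΦ hα) c hβΦ with hc | hc
  · exact (congrArg (· • α) hc).trans (one_smul ℝ α)
  · linarith [c.coe_nonneg]

end IsSimpleSubsystem

end SimpleSubsystems

/-! ### Words in the simple reflections -/

section Words

variable {Φ Γ A : Set V} {α : V} {w : V ≃ₗᵢ[ℝ] V}

/-- The product of the reflections in the vectors of a list, i.e. the group element represented by
a word in the generators of `reflGroup A` when the letters are in `A`. -/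
noncomputable def wordProd (l : List V) : V ≃ₗᵢ[ℝ] V := (l.map refl).prod

theorem wordProd_nil : wordProd ([] : List V) = 1 := rfl

theorem wordProd_cons (l : List V) : wordProd (α :: l) = refl α * wordProd l := by
  rw [wordProd, List.map_cons, List.prod_cons, wordProd]

theorem wordProd_concat (l : List V) : wordProd (l.concat α) = wordProd l * refl α := by
  rw [wordProd, List.map_concat, List.prod_concat, wordProd]

theorem wordProd_mem {l : List V} (hl : ∀ γ ∈ l, γ ∈ A) : wordProd l ∈ reflGroup A := by
  refine Subgroup.list_prod_mem _ fun x hx => ?_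
  obtain ⟨γ, hγ, rfl⟩ := List.mem_map.1 hx
  exact refl_mem_reflGroup (hl γ hγ)

theorem exists_wordProd_eq (hw : w ∈ reflGroup A) :
    ∃ l : List V, (∀ γ ∈ l, γ ∈ A) ∧ wordProd l = w := by
  refine reflGroup_induction (P := fun w => ∃ l : List V, (∀ γ ∈ l, γ ∈ A) ∧ wordProd l = w)
    ⟨[], fun _ => List.not_mem_nil.elim, wordProd_nil⟩ ?_ hw
  rintro α hα _ ⟨l, hl, rfl⟩
  exact ⟨α :: l, List.forall_mem_cons.2 ⟨hα, hl⟩, wordProd_cons l⟩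

namespace IsSimpleSubsystem

/-- The letter deleted is the one at which the partial products, applied to `α`, turn from positive
to negative roots: by `eq_of_neg_refl_mem` the root there is the letter itself. -/
theorem exchange (hΦ : IsRootSystem Φ) (hΓ : IsSimpleSubsystem Φ Γ) (hα : α ∈ Γ) (l : List V)
    (hl : ∀ γ ∈ l, γ ∈ Γ) (hneg : -wordProd l α ∈ Submodule.span ℝ≥0 Γ) :
    ∃ i < l.length, wordProd (l.eraseIdx i) = wordProd l * refl α := by
  induction l with
  | nil =>
    have hα0 : α = 0 := eq_zero_of_mem_span_of_neg_mem_span (hΓ.finite hΦ) (hΓ.linearIndepOn hΦ)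
      (Submodule.subset_span hα) hneg
    exact (hΦ.zero_notMem (hα0 ▸ hΓ.subset hΦ hα)).elim
  | cons γ l ih =>
    obtain ⟨hγ, hl⟩ := List.forall_mem_cons.1 hl
    have hroot : wordProd l α ∈ rootsOf Φ (reflGroup Γ) :=
      hΦ.apply_mem_rootsOf (hΓ.reflGroup_le hΦ) (wordProd_mem hl)
        ⟨hΓ.subset hΦ hα, refl_mem_reflGroup hα⟩
    rw [wordProd_cons] at hneg ⊢
    rcases hΓ.mem_or_neg_mem hΦ hroot with hpos | hneg'
    · have hγα : wordProd l α = γ := hΓ.eq_of_neg_refl_mem hΦ hγ hroot.1 hpos hneg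
      refine ⟨0, Nat.zero_lt_succ _, ?_⟩
      rw [← hγα, refl_apply_eq_conj, inv_mul_cancel_right, mul_assoc, refl_mul_self, mul_one]
      rfl
    · obtain ⟨i, hi, hil⟩ := ih hl hneg'
      refine ⟨i + 1, Nat.succ_lt_succ hi, ?_⟩
      rw [List.eraseIdx_cons_succ, wordProd_cons, hil, mul_assoc]

theorem descent_induction (hΦ : IsRootSystem Φ) (hΓ : IsSimpleSubsystem Φ Γ)
    {P : (V ≃ₗᵢ[ℝ] V) → Prop} (one : P 1)
    (descent : ∀ w ∈ reflGroup Γ, ∀ α ∈ Γ, -w α ∈ Submodule.span ℝ≥0 Γ → P (w * refl α) → P w)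
    (hw : w ∈ reflGroup Γ) : P w := by
  obtain ⟨l, hl, rfl⟩ := exists_wordProd_eq hw
  clear hw
  induction hk : l.length using Nat.strong_induction_on generalizing l with
  | _ k ih =>
    subst hk
    rcases l.eq_nil_or_concat with rfl | ⟨l, α, rfl⟩
    · exact one
    have hα : α ∈ Γ := hl α (by simp)
    have hlΓ : ∀ γ ∈ l, γ ∈ Γ := fun γ hγ => hl γ (by simp [hγ])
    have hroot : wordProd l α ∈ rootsOf Φ (reflGroup Γ) :=
      hΦ.apply_mem_rootsOf (hΓ.reflGroup_le hΦ) (wordProd_mem hlΓ)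
        ⟨hΓ.subset hΦ hα, refl_mem_reflGroup hα⟩
    rcases hΓ.mem_or_neg_mem hΦ hroot with hpos | hneg
    · refine descent _ (wordProd_mem hl) α hα ?_ ?_
      · rw [wordProd_concat]
        change -wordProd l (refl α α) ∈ _
        rwa [refl_self, map_neg, neg_neg]
      · rw [wordProd_concat, mul_assoc, refl_mul_self, mul_one]
        exact ih _ (by simp) l hlΓ rfl
    · obtain ⟨i, hi, hil⟩ := hΓ.exchange hΦ hα l hlΓ hneg
      rw [wordProd_concat, ← hil]
      refine ih _ ?_ _ (fun γ hγ => hlΓ γ (List.mem_of_mem_eraseIdx hγ)) rfl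
      rw [List.length_eraseIdx_of_lt hi, List.length_concat]
      omega

theorem mem_reflGroup_orthPart (hΦ : IsRootSystem Φ) (hΓ : IsSimpleSubsystem Φ Γ)
    (hw : w ∈ reflGroup Γ) {x : V} (hx : ∀ α ∈ Γ, 0 ≤ ⟪x, α⟫_ℝ)
    (hwx : ∀ α ∈ Γ, 0 ≤ ⟪w x, α⟫_ℝ) : w ∈ reflGroup (orthPart Γ x) := by
  refine hΓ.descent_induction hΦ
    (P := fun w => (∀ α ∈ Γ, 0 ≤ ⟪w x, α⟫_ℝ) → w ∈ reflGroup (orthPart Γ x))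
    (fun _ => one_mem _) (fun w _ α hα hneg ih hwx => ?_) hw hwx
  have hxα : ⟪x, α⟫_ℝ = 0 := by
    have h := inner_nonneg_of_mem_span hwx hneg
    rw [inner_neg_right, w.inner_map_map] at h
    linarith [hx α hα]
  have hwα : (w * refl α) x = w x := congrArg w (refl_eq_self_iff.2 hxα)
  have hαx : refl α ∈ reflGroup (orthPart Γ x) := refl_mem_reflGroup ⟨hα, hxα⟩
  exact (Subgroup.mul_mem_cancel_right _ hαx).1 (ih (hwα ▸ hwx))

/-- Maximise `⟨w⁻¹ v, ρ⟩` over the finite group `W_Γ`, where `ρ` is strictly dominant. -/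
theorem exists_dominant (hΦ : IsRootSystem Φ) (hΓ : IsSimpleSubsystem Φ Γ) (v : V) :
    ∃ w ∈ reflGroup Γ, ∀ α ∈ Γ, 0 ≤ ⟪w⁻¹ v, α⟫_ℝ := by
  obtain ⟨ρ, hρ⟩ := hΓ.exists_inner_pos hΦ
  obtain ⟨w, hw, hmax⟩ := Set.exists_max_image (reflGroup Γ : Set (V ≃ₗᵢ[ℝ] V))
    (fun w => ⟪w⁻¹ v, ρ⟫_ℝ) (hΦ.finite_reflGroup.subset (hΓ.reflGroup_le hΦ)) ⟨1, one_mem _⟩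
  refine ⟨w, hw, fun α hα => ?_⟩
  have hρα : 0 < ⟪α, ρ⟫_ℝ := real_inner_comm ρ α ▸ hρ α hα
  have hαα : 0 < ⟪α, α⟫_ℝ :=
    real_inner_self_pos.2 fun h0 => hΦ.zero_notMem (h0 ▸ hΓ.subset hΦ hα)
  have hle : ⟪refl α (w⁻¹ v), ρ⟫_ℝ ≤ ⟪w⁻¹ v, ρ⟫_ℝ := by
    have h := hmax (w * refl α) (mul_mem hw (refl_mem_reflGroup hα))
    rwa [mul_inv_rev, refl_inv] at h
  rw [refl_apply, inner_sub_left, real_inner_smul_left, sub_le_self_iff,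
    mul_nonneg_iff_of_pos_right hρα, le_div_iff₀ hαα, zero_mul] at hle
  linarith

end IsSimpleSubsystem

end Words

/-! ### Facets -/

section Facets

variable {Φ Γ Λ Δ Δ' : Set V} {v x f : V} {w : V ≃ₗᵢ[ℝ] V}

/-- The set `{v | ⟨v, Γ⟩ ≥ 0, ⟨v, Δ⟩ = 0}` cut out by the weak inequalities corresponding to those
defining `𝒞_{Γ,Δ}`; it is the closure of `𝒞_{Γ,Δ}` when the latter is non-empty. -/
def closedFacet (Γ Δ : Set V) : Set V :=
  {v | (∀ α ∈ Γ, 0 ≤ ⟪v, α⟫_ℝ) ∧ ∀ α ∈ Δ, ⟪v, α⟫_ℝ = 0}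

theorem facet_subset_closedFacet : facet Γ Δ ⊆ closedFacet Γ Δ := by
  refine fun v hv => ⟨fun α hα => ?_, hv.2⟩
  by_cases hαΔ : α ∈ Δ
  · exact (hv.2 α hαΔ).ge
  · exact (hv.1 α ⟨hα, hαΔ⟩).le

theorem mem_facet_orthPart (hv : ∀ α ∈ Γ, 0 ≤ ⟪v, α⟫_ℝ) : v ∈ facet Γ (orthPart Γ v) :=
  ⟨fun α hα => (hv α hα.1).lt_of_ne fun h => hα.2 ⟨hα.1, h.symm⟩, fun _ hα => hα.2⟩

theorem orthPart_eq_of_mem_facet (hΔ : Δ ⊆ Γ) (hv : v ∈ facet Γ Δ) : orthPart Γ v = Δ := by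
  refine Set.Subset.antisymm (fun α hα => ?_) fun α hα => ⟨hΔ hα, hv.2 α hα⟩
  by_contra hαΔ
  exact (hv.1 α ⟨hα.1, hαΔ⟩).ne' hα.2

theorem mem_facet_image_iff : x ∈ facet (w '' Γ) (w '' Δ) ↔ w⁻¹ x ∈ facet Γ Δ := by
  rw [facet, facet, ← Set.image_sdiff w.injective]
  simp only [Set.mem_ofPred_eq, Set.forall_mem_image, inner_inv_apply]

theorem isClosed_closedFacet : IsClosed (closedFacet Γ Δ) := by
  simp only [closedFacet, Set.ofPred_and, Set.ofPred_forall]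
  refine .inter (isClosed_biInter fun α _ => ?_) (isClosed_biInter fun α _ => ?_)
  · exact isClosed_le continuous_const (continuous_id.inner continuous_const)
  · exact isClosed_eq (continuous_id.inner continuous_const) continuous_const

theorem add_smul_mem_facet (hv : v ∈ closedFacet Γ Δ) (hf : f ∈ facet Γ Δ) {ε : ℝ} (hε : 0 < ε) :
    v + ε • f ∈ facet Γ Δ := by
  refine ⟨fun α hα => ?_, fun α hα => ?_⟩
  · rw [inner_add_left, real_inner_smul_left]
    exact add_pos_of_nonneg_of_pos (hv.1 α hα.1) (mul_pos hε (hf.1 α hα))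
  · rw [inner_add_left, real_inner_smul_left, hv.2 α hα, hf.2 α hα, mul_zero, add_zero]

theorem closure_facet (hne : (facet Γ Δ).Nonempty) : closure (facet Γ Δ) = closedFacet Γ Δ := by
  refine (closure_minimal facet_subset_closedFacet isClosed_closedFacet).antisymm fun v hv => ?_
  obtain ⟨f, hf⟩ := hne
  have hcont : Continuous fun ε : ℝ => v + ε • f := by fun_prop
  have hlim : Filter.Tendsto (fun ε : ℝ => v + ε • f) (nhdsWithin 0 (Set.Ioi 0)) (nhds v) :=
    (hcont.tendsto' 0 v (by simp)).mono_left nhdsWithin_le_nhds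
  refine mem_closure_of_tendsto hlim ?_
  filter_upwards [self_mem_nhdsWithin] with ε hε using add_smul_mem_facet hv hf hε

theorem facet_nonempty (hfin : Γ.Finite) (hΓ : LinearIndepOn ℝ id Γ) (hΔ : Δ ⊆ Γ) :
    (facet Γ Δ).Nonempty := by
  obtain ⟨v, hv, rfl⟩ := exists_nonneg_orthPart_eq hfin hΓ hΔ
  exact ⟨v, mem_facet_orthPart hv⟩

theorem eventually_sub_smul_mem_facet (hfin : Γ.Finite) (hx : x ∈ facet Γ Δ)
    (hf : ∀ α ∈ Δ, ⟪f, α⟫_ℝ = 0) : ∀ᶠ ε : ℝ in nhds 0, x - ε • f ∈ facet Γ Δ := by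
  have hpos : ∀ᶠ ε : ℝ in nhds 0, ∀ α ∈ Γ \ Δ, 0 < ⟪x - ε • f, α⟫_ℝ := by
    refine (Filter.eventually_all_finite hfin.sdiff).2 fun α hα => ?_
    have hcont : Continuous fun ε : ℝ => ⟪x - ε • f, α⟫_ℝ := by fun_prop
    exact (hcont.tendsto' 0 ⟪x, α⟫_ℝ (by simp)).eventually_const_lt (hx.1 α hα)
  filter_upwards [hpos] with ε hε
  refine ⟨hε, fun α hα => ?_⟩
  rw [inner_sub_left, real_inner_smul_left, hx.2 α hα, hf α hα, mul_zero, sub_zero]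

theorem facet_image_subset_closedFacet (hw : w ∈ cosetReps Φ Γ Λ)
    (hΔ : reflGroup Δ ≤ reflGroup (w '' Δ')) :
    facet (w '' Λ) (w '' Δ') ⊆ closedFacet Γ Δ := by
  intro v hv
  refine ⟨fun α hα => ?_, fun α hα => ?_⟩
  · have hdom := (facet_subset_closedFacet (mem_facet_image_iff.1 hv)).1
    have h := inner_nonneg_of_mem_span hdom (hw.2 (Set.mem_image_of_mem _ hα)).2
    rwa [LinearIsometryEquiv.inner_map_map] at h
  · exact refl_eq_self_iff.1 (apply_eq_self_of_mem_reflGroup (hΔ (refl_mem_reflGroup hα)) hv.2)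

namespace IsSimpleSubsystem

/-- If `ρ` is strictly dominant for `Γ`, then any `w` for which all `w⁻¹ (v + ε ρ)` with small
`ε > 0` are dominant works: to find one, first make `v` dominant, then move `ρ` inside the
stabiliser of the resulting vector. -/
theorem exists_cosetReps_dominant (hΦ : IsRootSystem Φ) (hΓ : IsSimpleSubsystem Φ Γ)
    (hΛ : IsSimpleSubsystem Φ Λ) (hΓΛ : reflGroup Γ ≤ reflGroup Λ)
    (hv : ∀ α ∈ Γ, 0 ≤ ⟪v, α⟫_ℝ) :
    ∃ w ∈ cosetReps Φ Γ Λ, ∀ α ∈ Λ, 0 ≤ ⟪w⁻¹ v, α⟫_ℝ := by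
  obtain ⟨ρ, hρ⟩ := hΓ.exists_inner_pos hΦ
  obtain ⟨w, hw, hwv⟩ := hΛ.exists_dominant hΦ v
  set J := orthPart Λ (w⁻¹ v)
  obtain ⟨q, hq, hqρ⟩ := (hΛ.mono hΦ (orthPart_subset : J ⊆ Λ)).exists_dominant hΦ (w⁻¹ ρ)
  have hwq : w * q ∈ reflGroup Λ := mul_mem hw (reflGroup_mono orthPart_subset hq)
  have hwqv : (w * q)⁻¹ v = w⁻¹ v := by
    rw [mul_inv_rev]
    exact apply_eq_self_of_mem_reflGroup (inv_mem hq) fun α hα => hα.2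
  refine ⟨w * q, ⟨hwq, Set.image_subset_iff.2 fun γ hγ => ?_⟩, hwqv ▸ hwv⟩
  have hroot : (w * q)⁻¹ γ ∈ rootsOf Φ (reflGroup Λ) :=
    hΦ.apply_mem_rootsOf (hΛ.reflGroup_le hΦ) (inv_mem hwq)
      ⟨hΓ.subset hΦ hγ, hΓΛ (refl_mem_reflGroup hγ)⟩
  refine ⟨hroot, (hΛ.mem_or_neg_mem hΦ hroot).resolve_right fun hneg => ?_⟩
  have hnegJ : -(w * q)⁻¹ γ ∈ Submodule.span ℝ≥0 J := by
    refine mem_span_orthPart hwv hneg ?_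
    rw [← hwqv, inner_neg_right, LinearIsometryEquiv.inner_map_map, neg_nonpos]
    exact hv γ hγ
  have hργ := inner_nonneg_of_mem_span hqρ hnegJ
  rw [show q⁻¹ (w⁻¹ ρ) = (w * q)⁻¹ ρ by rw [mul_inv_rev]; rfl, inner_neg_right,
    LinearIsometryEquiv.inner_map_map] at hργ
  linarith [hρ γ hγ]

theorem exists_mem_facet_image (hΦ : IsRootSystem Φ) (hΓ : IsSimpleSubsystem Φ Γ)
    (hΛ : IsSimpleSubsystem Φ Λ) (hΓΛ : reflGroup Γ ≤ reflGroup Λ) (hΔ : Δ ⊆ Γ)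
    (hv : v ∈ closedFacet Γ Δ) :
    ∃ w ∈ cosetReps Φ Γ Λ, ∃ Δ' ⊆ Λ,
      v ∈ facet (w '' Λ) (w '' Δ') ∧ reflGroup Δ ≤ reflGroup (w '' Δ') := by
  obtain ⟨w, hw, hdom⟩ := hΓ.exists_cosetReps_dominant hΦ hΛ hΓΛ hv.1
  refine ⟨w, hw, orthPart Λ (w⁻¹ v), orthPart_subset,
    mem_facet_image_iff.2 (mem_facet_orthPart hdom), reflGroup_le_iff.2 fun α hα => ?_⟩
  have hmem : w⁻¹ * refl α * w ∈ reflGroup Λ :=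
    mul_mem (mul_mem (inv_mem hw.1) (hΓΛ (refl_mem_reflGroup (hΔ hα)))) hw.1
  have hfix : (w⁻¹ * refl α * w) (w⁻¹ v) = w⁻¹ v := by
    change w⁻¹ (refl α (w (w⁻¹ v))) = w⁻¹ v
    rw [apply_inv_apply, refl_eq_self_iff.2 (hv.2 α hα)]
  rw [mem_reflGroup_image_iff]
  exact hΛ.mem_reflGroup_orthPart hΦ hmem hdom (hfix.symm ▸ hdom)

theorem mem_reflGroup_and_eq_of_mem_facet (hΦ : IsRootSystem Φ) (hΓ : IsSimpleSubsystem Φ Γ)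
    (hw : w ∈ reflGroup Γ) (hΔ : Δ ⊆ Γ) (hΔ' : Δ' ⊆ Γ) (hx : x ∈ facet Γ Δ)
    (hwx : w x ∈ facet Γ Δ') : w ∈ reflGroup Δ ∧ Δ = Δ' := by
  have hwΔ : w ∈ reflGroup Δ := orthPart_eq_of_mem_facet hΔ hx ▸ hΓ.mem_reflGroup_orthPart hΦ hw
    (facet_subset_closedFacet hx).1 (facet_subset_closedFacet hwx).1
  rw [apply_eq_self_of_mem_reflGroup hwΔ hx.2] at hwx
  exact ⟨hwΔ, (orthPart_eq_of_mem_facet hΔ hx).symm.trans (orthPart_eq_of_mem_facet hΔ' hwx)⟩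

end IsSimpleSubsystem

end Facets

/-! ### Partial products -/

theorem exists_fin_sequence {n : ℕ} {S : Type*} {P : Fin (n + 1) → S → Prop}
    {R : Fin n → S → S → Prop} {s₀ : S} (zero : P 0 s₀)
    (succ : ∀ i s, P i.castSucc s → ∃ s', P i.succ s' ∧ R i s s') :
    ∃ s : Fin (n + 1) → S,
      s 0 = s₀ ∧ (∀ k, P k (s k)) ∧ ∀ i : Fin n, R i (s i.castSucc) (s i.succ) := by
  choose next hnext hR using succ
  let s (k : Fin (n + 1)) : {s // P k s} :=
    Fin.induction (motive := fun k => {s // P k s}) ⟨s₀, zero⟩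
      (fun i s => ⟨next i s s.2, hnext i s s.2⟩) k
  exact ⟨fun k => s k, rfl, fun k => (s k).2, fun i => hR i _ (s i.castSucc).2⟩

section PartialProducts

variable {n : ℕ} {w : Fin n → (V ≃ₗᵢ[ℝ] V)} {d : Fin (n + 1) → Set V}

theorem revProd_mul_inv (p : Fin (n + 1) → (V ≃ₗᵢ[ℝ] V)) (hp : p 0 = 1) :
    revProd (fun i => p i.succ * (p i.castSucc)⁻¹) = p := by
  funext k
  induction k using Fin.induction with
  | zero => rw [revProd_zero, hp]
  | succ i ih => rw [revProd_succ, ih, inv_mul_cancel_right]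

theorem revProd_mem (hd : Antitone d)
    (hw : ∀ i : Fin n, w i ∈ reflGroup (revProd w i.castSucc '' d i.castSucc))
    (k : Fin (n + 1)) : revProd w k ∈ reflGroup (d 0) := by
  induction k using Fin.induction with
  | zero => exact one_mem _
  | succ i ih =>
    refine mul_mem ?_ ih
    rw [← reflGroup_image_of_mem ih]
    exact reflGroup_mono (Set.image_mono (hd (Fin.zero_le _))) (hw i)

theorem revProd_apply_eq_of_le (hd : Antitone d)
    (hw : ∀ i : Fin n, w i ∈ reflGroup (revProd w i.castSucc '' d i.castSucc))
    {k l : Fin (n + 1)} (hkl : k ≤ l) {y : V} (hy : ∀ α ∈ d k, ⟪y, α⟫_ℝ = 0) :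
    revProd w l y = revProd w k y := by
  induction l using Fin.induction with
  | zero => rw [Fin.le_zero_iff.1 hkl]
  | succ i ih =>
    rcases hkl.eq_or_lt with rfl | hlt
    · rfl
    have hki : k ≤ i.castSucc := Fin.le_castSucc_iff.2 hlt
    rw [← ih hki, revProd_succ]
    refine apply_eq_self_of_mem_reflGroup (hw i) (Set.forall_mem_image.2 fun α hα => ?_)
    exact ((revProd w i.castSucc).inner_map_map y α).trans (hy α (hd hki hα))

/-- The factors `w_{k+1}, …, w_n` of `w_n ⋯ w_1` do not move the `k`-th component. -/
theorem mem_diag_revProd_image_iff (hd : Antitone d)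
    (hw : ∀ i : Fin n, w i ∈ reflGroup (revProd w i.castSucc '' d i.castSucc)) {v : Fin n → V} :
    v ∈ diag n (revProd w (Fin.last n)) '' stdStratum d ↔
      ∀ i : Fin n,
        v i ∈ facet (revProd w i.succ '' d i.castSucc) (revProd w i.succ '' d i.succ) := by
  have hfix : ∀ (i : Fin n) (y : V), y ∈ facet (d i.castSucc) (d i.succ) →
      revProd w (Fin.last n) y = revProd w i.succ y :=
    fun i y hy => revProd_apply_eq_of_le hd hw (Fin.le_last _) hy.2
  simp only [mem_facet_image_iff]
  constructor
  · rintro ⟨y, hy, rfl⟩ i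
    rw [diag, hfix i (y i) (hy i), inv_apply_apply]
    exact hy i
  · exact fun hv => ⟨_, hv, funext fun i => (hfix i _ (hv i)).trans (apply_inv_apply _ _)⟩

end PartialProducts

/-! ### Strata and their closures -/

section Strata

variable {n : ℕ} {Φ Γ Λ : Set V} {c d : Fin (n + 1) → Set V} {w : Fin n → (V ≃ₗᵢ[ℝ] V)}
  {u : V ≃ₗᵢ[ℝ] V} {v : Fin n → V} {F G : Set (Fin n → V)}

/-- The product of the closed facets corresponding to the factors of `𝒳_c`. -/
def closedStratum (c : Fin (n + 1) → Set V) : Set (Fin n → V) :=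
  {v | ∀ i : Fin n, v i ∈ closedFacet (c i.castSucc) (c i.succ)}

theorem diag_image_stdStratum (u : V ≃ₗᵢ[ℝ] V) (c : Fin (n + 1) → Set V) :
    diag n u '' stdStratum c = stdStratum fun i => u '' c i := by
  ext v
  simp only [stdStratum, Set.mem_ofPred_eq, mem_facet_image_iff]
  constructor
  · rintro ⟨y, hy, rfl⟩ i
    rw [diag, inv_apply_apply]
    exact hy i
  · exact fun hv => ⟨_, hv, funext fun i => apply_inv_apply u (v i)⟩

theorem facet_succ_nonempty (hΦ : IsRootSystem Φ) (hc : Antitone c)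
    (hc0 : IsSimpleSubsystem Φ (c 0)) (i : Fin n) : (facet (c i.castSucc) (c i.succ)).Nonempty := by
  have hci : IsSimpleSubsystem Φ (c i.castSucc) := hc0.mono hΦ (hc (Fin.zero_le _))
  exact facet_nonempty (hci.finite hΦ) (hci.linearIndepOn hΦ) (hc i.castSucc_le_succ)

theorem stdStratum_nonempty (hΦ : IsRootSystem Φ) (hc : Antitone c)
    (hc0 : IsSimpleSubsystem Φ (c 0)) : (stdStratum c).Nonempty := by
  choose v hv using facet_succ_nonempty hΦ hc hc0
  exact ⟨v, hv⟩

theorem closure_stdStratum (hΦ : IsRootSystem Φ) (hc : Antitone c)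
    (hc0 : IsSimpleSubsystem Φ (c 0)) : closure (stdStratum c) = closedStratum c := by
  have hpi : stdStratum c = Set.univ.pi fun i : Fin n => facet (c i.castSucc) (c i.succ) := by
    ext v
    exact Set.mem_univ_pi.symm
  rw [hpi, closure_pi_set]
  ext v
  simp only [closure_facet (facet_succ_nonempty hΦ hc hc0 _), Set.mem_univ_pi]
  rfl

theorem ClosureIndex.image_subset_closedStratum (hcd : ClosureIndex Φ c w d) (hd : Antitone d) :
    diag n (revProd w (Fin.last n)) '' stdStratum d ⊆ closedStratum c := by
  intro v hv i
  have hvi := (mem_diag_revProd_image_iff hd fun i => (hcd.1 i).1).1 hv i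
  have hle := hcd.2 i
  rw [revProd_succ, mul_image, mul_image] at hvi
  rw [revProd_succ, mul_image] at hle
  exact facet_image_subset_closedFacet (hcd.1 i) hle hvi

theorem IsSimpleSubsystem.exists_mul_inv_mem_cosetReps (hΦ : IsRootSystem Φ)
    (hΓ : IsSimpleSubsystem Φ Γ) (hΛ : IsSimpleSubsystem Φ Λ) {Γ' Δ : Set V} {p : V ≃ₗᵢ[ℝ] V}
    (hp : p ∈ reflGroup Λ) (hΔ : Δ ⊆ Λ) (hΓΔ : reflGroup Γ ≤ reflGroup (p '' Δ)) (hΓ' : Γ' ⊆ Γ)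
    {x : V} (hx : x ∈ closedFacet Γ Γ') :
    ∃ p' ∈ reflGroup Λ, ∃ Δ' ⊆ Δ, p' * p⁻¹ ∈ cosetReps Φ Γ (p '' Δ) ∧
      x ∈ facet (p' '' Δ) (p' '' Δ') ∧ reflGroup Γ' ≤ reflGroup (p' '' Δ') := by
  have hpΔ : IsSimpleSubsystem Φ (p '' Δ) := (hΛ.mono hΦ hΔ).image hΦ (hΛ.reflGroup_le hΦ hp)
  obtain ⟨w, hw, _, hpΔ', hxw, hle⟩ := hΓ.exists_mem_facet_image hΦ hpΔ hΓΔ hΓ' hx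
  obtain ⟨Δ', hΔ', rfl⟩ := Set.subset_image_iff.1 hpΔ'
  have hwΛ : w ∈ reflGroup Λ :=
    reflGroup_image_of_mem hp ▸ reflGroup_mono (Set.image_mono hΔ) hw.1
  rw [← mul_image, ← mul_image] at hxw
  rw [← mul_image] at hle
  exact ⟨w * p, mul_mem hwΛ hp, Δ', hΔ', by rwa [mul_inv_cancel_right], hxw, hle⟩

theorem exists_closureIndex (hΦ : IsRootSystem Φ) (hc : Antitone c)
    (hc0 : IsSimpleSubsystem Φ (c 0)) (hΛ : IsSimpleSubsystem Φ Λ)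
    (hcΛ : reflGroup (c 0) ≤ reflGroup Λ) (hv : v ∈ closedStratum c) :
    ∃ w d, (∀ i, w i ∈ reflGroup Φ) ∧ IsFlag Λ d ∧ ClosureIndex Φ c w d ∧
      v ∈ diag n (revProd w (Fin.last n)) '' stdStratum d := by
  let P : Fin (n + 1) → (V ≃ₗᵢ[ℝ] V) × Set V → Prop := fun k s =>
    s.1 ∈ reflGroup Λ ∧ s.2 ⊆ Λ ∧ reflGroup (c k) ≤ reflGroup (s.1 '' s.2)
  let R : Fin n → (V ≃ₗᵢ[ℝ] V) × Set V → (V ≃ₗᵢ[ℝ] V) × Set V → Prop := fun i s s' =>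
    s'.2 ⊆ s.2 ∧ s'.1 * s.1⁻¹ ∈ cosetReps Φ (c i.castSucc) (s.1 '' s.2) ∧
      v i ∈ facet (s'.1 '' s.2) (s'.1 '' s'.2)
  have zero : P 0 (1, Λ) := ⟨one_mem _, subset_rfl, by simpa using hcΛ⟩
  have succ : ∀ i s, P i.castSucc s → ∃ s', P i.succ s' ∧ R i s s' := by
    rintro i ⟨p, Δ⟩ ⟨hp, hΔ, hcΔ⟩
    have hci : IsSimpleSubsystem Φ (c i.castSucc) := hc0.mono hΦ (hc (Fin.zero_le _))
    obtain ⟨p', hp', Δ', hΔ', hpp', hvi, hcΔ'⟩ := hci.exists_mul_inv_mem_cosetReps hΦ hΛ hp hΔ hcΔ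
      (hc i.castSucc_le_succ) (hv i)
    exact ⟨(p', Δ'), ⟨hp', hΔ'.trans hΔ, hcΔ'⟩, hΔ', hpp', hvi⟩
  obtain ⟨s, hs0, hP, hR⟩ := exists_fin_sequence zero succ
  have hp : revProd (fun i => (s i.succ).1 * (s i.castSucc).1⁻¹) = fun k => (s k).1 :=
    revProd_mul_inv (fun k => (s k).1) (congrArg Prod.fst hs0)
  have hd : Antitone fun k => (s k).2 := Fin.antitone_iff_succ_le.2 fun i => (hR i).1
  have hidx : ClosureIndex Φ c (fun i => (s i.succ).1 * (s i.castSucc).1⁻¹) fun k => (s k).2 := by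
    rw [ClosureIndex, hp]
    exact ⟨fun i => (hR i).2.1, fun i => (hP i.succ).2.2⟩
  refine ⟨_, _, fun i => hΛ.reflGroup_le hΦ (mul_mem (hP _).1 (inv_mem (hP _).1)),
    ⟨congrArg Prod.snd hs0, hd⟩, hidx,
    (mem_diag_revProd_image_iff hd fun i => (hidx.1 i).1).2 ?_⟩
  rw [hp]
  exact fun i => (hR i).2.2

theorem closure_diag_image_stdStratum (hΦ : IsRootSystem Φ) (hΓ : IsSimpleSubsystem Φ Γ)
    (hΛ : IsSimpleSubsystem Φ Λ) (hΓΛ : reflGroup Γ ≤ reflGroup Λ) (hu : u ∈ reflGroup Γ)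
    (hc : IsFlag Γ c) :
    closure (diag n u '' stdStratum c) =
      ⋃ (w : Fin n → (V ≃ₗᵢ[ℝ] V)) (_ : ∀ i, w i ∈ reflGroup Φ)
        (d : Fin (n + 1) → Set V) (_ : IsFlag Λ d) (_ : ClosureIndex Φ (fun i => u '' c i) w d),
        diag n (revProd w (Fin.last n)) '' stdStratum d := by
  have hanti : Antitone fun i => u '' c i := fun i j hij => Set.image_mono (hc.2 hij)
  have huc0 : IsSimpleSubsystem Φ (u '' c 0) := hc.1 ▸ hΓ.image hΦ (hΓ.reflGroup_le hΦ hu)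
  have hle : reflGroup (u '' c 0) ≤ reflGroup Λ := by rwa [hc.1, reflGroup_image_of_mem hu]
  rw [diag_image_stdStratum, closure_stdStratum hΦ hanti huc0]
  ext v
  simp only [Set.mem_iUnion, exists_prop]
  constructor
  · intro hv
    obtain ⟨w, d, hw, hd, hcd, hvd⟩ := exists_closureIndex hΦ hanti huc0 hΛ hle hv
    exact ⟨w, hw, d, hd, hcd, hvd⟩
  · rintro ⟨w, -, d, hd, hcd, hvd⟩
    exact hcd.image_subset_closedStratum hd.2 hvd

theorem IsStratum.exists_eq_stdStratum (hΦ : IsRootSystem Φ) (hΓ : IsSimpleSubsystem Φ Γ)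
    (hF : IsStratum Γ F) :
    ∃ c : Fin (n + 1) → Set V, Antitone c ∧ IsSimpleSubsystem Φ (c 0) ∧ F = stdStratum c := by
  obtain ⟨u, hu, c, hc, rfl⟩ := hF
  have huc0 : IsSimpleSubsystem Φ (u '' c 0) := hc.1 ▸ hΓ.image hΦ (hΓ.reflGroup_le hΦ hu)
  exact ⟨fun i => u '' c i, fun i j hij => Set.image_mono (hc.2 hij), huc0,
    diag_image_stdStratum u c⟩

theorem IsStratum.nonempty (hΦ : IsRootSystem Φ) (hΓ : IsSimpleSubsystem Φ Γ)
    (hF : IsStratum Γ F) : F.Nonempty := by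
  obtain ⟨c, hc, hc0, rfl⟩ := hF.exists_eq_stdStratum hΦ hΓ
  exact stdStratum_nonempty hΦ hc hc0

theorem add_smul_mem_stdStratum {f : Fin n → V} (hv : v ∈ closedStratum c)
    (hf : f ∈ stdStratum c) {ε : ℝ} (hε : 0 < ε) : v + ε • f ∈ stdStratum c :=
  fun i => add_smul_mem_facet (hv i) (hf i) hε

theorem exists_sub_smul_mem_stdStratum (hfin : ∀ k, (c k).Finite) {f : Fin n → V}
    (hv : v ∈ stdStratum c) (hf : f ∈ Submodule.span ℝ (stdStratum c)) :
    ∃ ε : ℝ, 0 < ε ∧ v - ε • f ∈ stdStratum c := by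
  have hf0 (i : Fin n) (α : V) (hα : α ∈ c i.succ) : ⟪f i, α⟫_ℝ = 0 := by
    induction hf using Submodule.span_induction with
    | mem y hy => exact (hy i).2 α hα
    | zero => exact inner_zero_left α
    | add y z _ _ hy hz => rw [Pi.add_apply, inner_add_left, hy, hz, add_zero]
    | smul a y _ hy => rw [Pi.smul_apply, real_inner_smul_left, hy, mul_zero]
  have hev : ∀ᶠ ε : ℝ in nhds 0, v - ε • f ∈ stdStratum c :=
    Filter.eventually_all.2 fun i => eventually_sub_smul_mem_facet (hfin _) (hv i) (hf0 i)
  have hpos : ∀ᶠ ε : ℝ in nhdsWithin 0 (Set.Ioi 0), 0 < ε := self_mem_nhdsWithin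
  exact (hpos.and (nhdsWithin_le_nhds hev)).exists

/-- A point `v` of `G` can be moved away from `f` within `G`, since `G` is relatively open in its
span, and moving it back towards `f` from there leads from the closure of `F` into `F`. -/
theorem IsStratum.subset_of_subset_closure (hΦ : IsRootSystem Φ) (hΓ : IsSimpleSubsystem Φ Γ)
    (hΛ : IsSimpleSubsystem Φ Λ) (hF : IsStratum Γ F) (hG : IsStratum Λ G) (hGF : G ⊆ closure F)
    {f : Fin n → V} (hf : f ∈ F) (hfG : f ∈ Submodule.span ℝ G) : G ⊆ F := by
  obtain ⟨c, hc, hc0, rfl⟩ := hF.exists_eq_stdStratum hΦ hΓ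
  obtain ⟨d, hd, hd0, rfl⟩ := hG.exists_eq_stdStratum hΦ hΛ
  rw [closure_stdStratum hΦ hc hc0] at hGF
  intro v hv
  have hfin (k : Fin (n + 1)) : (d k).Finite := (hd0.finite hΦ).subset (hd (Fin.zero_le k))
  obtain ⟨ε, hε, hvε⟩ := exists_sub_smul_mem_stdStratum hfin hv hfG
  exact sub_add_cancel v (ε • f) ▸ add_smul_mem_stdStratum (hGF hvε) hf hε

theorem IsSimpleSubsystem.eq_of_mem_stdStratum (hΦ : IsRootSystem Φ)
    (hΓ : IsSimpleSubsystem Φ Γ) (hc : IsFlag Γ c) (hd : IsFlag Γ d) (hu : u ∈ reflGroup Γ)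
    (hv : v ∈ stdStratum c) (huv : diag n u v ∈ stdStratum d) :
    c = d ∧ ∀ y ∈ stdStratum c, diag n u y = y := by
  have hcd (k : Fin (n + 1)) : u ∈ reflGroup (c k) ∧ c k = d k := by
    induction k using Fin.induction with
    | zero => exact hc.1.symm ▸ ⟨hu, hd.1.symm⟩
    | succ i ih =>
      have hci : IsSimpleSubsystem Φ (c i.castSucc) :=
        hΓ.mono hΦ (hc.1 ▸ hc.2 (Fin.zero_le _))
      have huvi := huv i
      rw [← ih.2] at huvi
      exact hci.mem_reflGroup_and_eq_of_mem_facet hΦ ih.1 (hc.2 i.castSucc_le_succ)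
        (ih.2 ▸ hd.2 i.castSucc_le_succ) (hv i) huvi
  exact ⟨funext fun k => (hcd k).2, fun y hy => funext fun i =>
    apply_eq_self_of_mem_reflGroup (hcd i.succ).1 (hy i).2⟩

theorem IsStratum.eq_of_mem (hΦ : IsRootSystem Φ) (hΓ : IsSimpleSubsystem Φ Γ)
    (hF : IsStratum Γ F) (hG : IsStratum Γ G) (hvF : v ∈ F) (hvG : v ∈ G) : F = G := by
  obtain ⟨u, hu, c, hc, rfl⟩ := hF
  obtain ⟨g, hg, d, hd, rfl⟩ := hG
  obtain ⟨x, hx, rfl⟩ := hvF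
  obtain ⟨y, hy, hyx⟩ := hvG
  have hgux : diag n (g⁻¹ * u) x = y := funext fun i => by
    calc g⁻¹ (u (x i)) = g⁻¹ (g (y i)) := congrArg (fun z => g⁻¹ z) (congrFun hyx i).symm
      _ = y i := inv_apply_apply g (y i)
  obtain ⟨rfl, hfix⟩ := hΓ.eq_of_mem_stdStratum hΦ hc hd (mul_mem (inv_mem hg) hu) hx (hgux ▸ hy)
  refine Set.image_congr fun z hz => funext fun i => ?_
  calc u (z i) = g ((g⁻¹ * u) (z i)) := (apply_inv_apply g (u (z i))).symm
    _ = g (z i) := congrArg g (congrFun (hfix z hz) i)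

theorem pairwiseDisjoint_isStratum (hΦ : IsRootSystem Φ) (hΓ : IsSimpleSubsystem Φ Γ) :
    {F : Set (Fin n → V) | IsStratum Γ F}.PairwiseDisjoint id :=
  fun _ hF _ hG hne => Set.disjoint_left.2 fun _ hvF hvG =>
    hne (IsStratum.eq_of_mem hΦ hΓ hF hG hvF hvG)

theorem IsStratum.closure_eq_sUnion (hΦ : IsRootSystem Φ) (hΓ : IsSimpleSubsystem Φ Γ)
    (hΛ : IsSimpleSubsystem Φ Λ) (hΓΛ : reflGroup Γ ≤ reflGroup Λ) (hF : IsStratum Γ F) :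
    closure F = ⋃₀ {G | IsStratum Λ G ∧ G ⊆ closure F} := by
  refine Set.Subset.antisymm (fun v hv => ?_) (Set.sUnion_subset fun G hG => hG.2)
  obtain ⟨u, hu, c, hc, rfl⟩ := hF
  rw [closure_diag_image_stdStratum hΦ hΓ hΛ hΓΛ hu hc] at hv ⊢
  simp only [Set.mem_iUnion] at hv
  obtain ⟨w, hw, d, hd, hcd, hvd⟩ := hv
  have hwΛ : revProd w (Fin.last n) ∈ reflGroup Λ :=
    hd.1 ▸ revProd_mem hd.2 (fun i => (hcd.1 i).1) _
  refine ⟨_, ⟨⟨_, hwΛ, d, hd, rfl⟩, fun x hx => ?_⟩, hvd⟩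
  simp only [Set.mem_iUnion]
  exact ⟨w, hw, d, hd, hcd, hx⟩

theorem IsStratum.eq_sUnion (hΦ : IsRootSystem Φ) (hΓ : IsSimpleSubsystem Φ Γ)
    (hΛ : IsSimpleSubsystem Φ Λ) (hΓΛ : reflGroup Γ ≤ reflGroup Λ) (hF : IsStratum Γ F) :
    F = ⋃₀ {G | IsStratum Λ G ∧ G ⊆ F} := by
  refine Set.Subset.antisymm (fun v hv => ?_) (Set.sUnion_subset fun G hG => hG.2)
  obtain ⟨G, ⟨hG, hGF⟩, hvG⟩ := (hF.closure_eq_sUnion hΦ hΓ hΛ hΓΛ).subset (subset_closure hv)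
  exact ⟨G, ⟨hG, hF.subset_of_subset_closure hΦ hΓ hΛ hG hGF hv (Submodule.subset_span hvG)⟩, hvG⟩

theorem IsStratum.coneDim_lt [FiniteDimensional ℝ V] (hΦ : IsRootSystem Φ)
    (hΓ : IsSimpleSubsystem Φ Γ) (hF : IsStratum Γ F) (hG : IsStratum Γ G)
    (hGF : G ⊆ closure F) (hne : G ≠ F) : coneDim G < coneDim F := by
  have hle : Submodule.span ℝ G ≤ Submodule.span ℝ F :=
    Submodule.span_le.2 <| hGF.trans <|
      closure_minimal Submodule.subset_span (Submodule.closed_of_finiteDimensional _)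
  refine Submodule.finrank_lt_finrank_of_lt (hle.lt_of_ne fun heq => hne ?_)
  obtain ⟨f, hf⟩ := hF.nonempty hΦ hΓ
  obtain ⟨v, hv⟩ := hG.nonempty hΦ hΓ
  have hfG : f ∈ Submodule.span ℝ G := heq ▸ Submodule.subset_span hf
  exact hG.eq_of_mem hΦ hΓ hF hv (hF.subset_of_subset_closure hΦ hΓ hΓ hG hGF hf hfG hv)

end Strata

end ReflStrata

theorem theorem3p6 {V : Type*} [NormedAddCommGroup V] [InnerProductSpace ℝ V]
    [FiniteDimensional ℝ V] (Φ : Set V) (hΦ : ReflStrata.IsRootSystem Φ)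
    (Γ Λ : Set V) (hΓ : ReflStrata.IsSimpleSubsystem Φ Γ)
    (hΛ : ReflStrata.IsSimpleSubsystem Φ Λ)
    (hΓΛ : ReflStrata.reflGroup Γ ≤ ReflStrata.reflGroup Λ) (n : ℕ) (hn : 1 ≤ n) :
    -- the closure of any `W_Γ`-stratum is a union of `W_Λ`-strata
    (∀ F' : Set (Fin n → V), ReflStrata.IsStratum Γ F' →
      ∃ 𝓕 : Set (Set (Fin n → V)), (∀ F ∈ 𝓕, ReflStrata.IsStratum Λ F) ∧
        closure F' = ⋃₀ 𝓕) ∧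
    -- the explicit formula for the closure of the stratum `u(𝒳_c) = 𝒳_{u(c)}`
    (∀ u ∈ ReflStrata.reflGroup Γ, ∀ c : Fin (n + 1) → Set V, ReflStrata.IsFlag Γ c →
      closure (ReflStrata.diag n u '' ReflStrata.stdStratum c) =
        ⋃ (w : Fin n → (V ≃ₗᵢ[ℝ] V)) (_ : ∀ i, w i ∈ ReflStrata.reflGroup Φ)
          (d : Fin (n + 1) → Set V) (_ : ReflStrata.IsFlag Λ d)
          (_ : ReflStrata.ClosureIndex Φ (fun i => u '' c i) w d),
          ReflStrata.diag n (ReflStrata.revProd w (Fin.last n)) '' ReflStrata.stdStratum d) ∧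
    -- the closure of a stratum is the disjoint union of it and strata of smaller dimension
    (∀ F : Set (Fin n → V), ReflStrata.IsStratum Γ F →
      ∃ 𝓕 : Set (Set (Fin n → V)),
        (∀ G ∈ 𝓕, ReflStrata.IsStratum Γ G ∧ ReflStrata.coneDim G < ReflStrata.coneDim F) ∧
        (insert F 𝓕).PairwiseDisjoint id ∧ closure F = ⋃₀ insert F 𝓕) ∧
    -- any `W_Γ`-stratum is a union of `W_Λ`-strata
    (∀ F' : Set (Fin n → V), ReflStrata.IsStratum Γ F' →
      ∃ 𝓕 : Set (Set (Fin n → V)), (∀ F ∈ 𝓕, ReflStrata.IsStratum Λ F) ∧ F' = ⋃₀ 𝓕) := by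
  refine ⟨fun F hF => ?_, fun u hu c hc => ?_, fun F hF => ?_, fun F hF => ?_⟩
  · exact ⟨_, fun _ hG => hG.1, hF.closure_eq_sUnion hΦ hΓ hΛ hΓΛ⟩
  · exact ReflStrata.closure_diag_image_stdStratum hΦ hΓ hΛ hΓΛ hu hc
  · let 𝓖 := {G | ReflStrata.IsStratum Γ G ∧ G ⊆ closure F}
    have hins : insert F (𝓖 \ {F}) = 𝓖 := Set.insert_sdiff_self_of_mem ⟨hF, subset_closure⟩
    refine ⟨𝓖 \ {F}, fun G hG => ⟨hG.1.1, hF.coneDim_lt hΦ hΓ hG.1.1 hG.1.2 hG.2⟩, ?_, ?_⟩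
    · rw [hins]
      exact (ReflStrata.pairwiseDisjoint_isStratum hΦ hΓ).subset fun _ hG => hG.1
    · rw [hins]
      exact hF.closure_eq_sUnion hΦ hΓ hΓ le_rfl
  · exact ⟨_, fun _ hG => hG.1, hF.eq_sUnion hΦ hΓ hΛ hΓΛ⟩
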